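/- Consider $N$ qubits labelled by $[N]=\{1,\dots,N\}$, a subset $A\subsetneq[N]$ of measured qubits with complement $B=[N]\setminus A$, a set $\varnothing\neq s\subseteq B$, and a unit vector $|\Psi\rangle\in(\mathbb{C}^2)^{\otimes N}=\mathcal H_A\otimes\mathcal H_B$. For a state $|\varphi\rangle\in\mathcal H_B$ the concentratable entanglement with respect to $s$ is $\mathrm{CE}(|\varphi\rangle)=1-2^{-|s|}\sum_{\gamma\subseteq s}\operatorname{tr}(\varphi_\gamma^2)$, where $\varphi_\gamma$ is the reduced state of $|\varphi\rangle\langle\varphi|$ on the qubits in $\gamma$. For a real-valued function $E$ on states of $\mathcal H_B$, the localizable entanglement is $$L^{E}(|\Psi\rangle)=\max_{\{|e_k\rangle\}}\ \sum_{k}p_k\,E(|\varphi_k\rangle),\qquad p_k=\big\|(\langle e_k|_A\otimes I_B)|\Psi\rangle\big\|^2,\quad |\varphi_k\rangle=p_k^{-1/2}(\langle e_k|_A\otimes I_B)|\Psi\rangle ,$$ where terms with $p_k=0$ count as $0$ and the maximum is over all orthonormal bases $\{|e_k\rangle\}$ of $\mathcal H_A$ each of whose elements is a product vector $\bigotimes_{a\in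 A}|v_a\rangle$ (that is, over all rank-one projective measurements on $A$ whose projectors have tensor product form). For $i\neq j\in B$ and $\vec a,\vec b\in\mathbb{R}^3$ put $$Q^{ij}_{\vec a,\vec b}(|\Psi\rangle)=\langle\Psi|(\vec a\cdot\vec\sigma^{(i)})\otimes(\vec b\cdot\vec\sigma^{(j)})|\Psi\rangle-\langle\Psi|\vec a\cdot\vec\sigma^{(i)}|\Psi\rangle\,\langle\Psi|\vec b\cdot\vec\sigma^{(j)}|\Psi\rangle ,$$ where $\vec\sigma^{(i)}$ is the vector of Pauli matrices acting on qubit $i$, and let $\mathbf Q^{ij}(|\Psi\rangle)$ be the real $3\times3$ matrix with entries $Q^{ij}_{\hat e_p,\hat e_q}(|\Psi\rangle)$. Theorem. The maxima defining $L^{\mathrm{CE}}(|\Psi\rangle)$ and $L^{\sqrt{\mathrm{CE}}}(|\Psi\rangle)$ are attained, and $$\sqrt{L^{\mathrm{CE}}(|\Psi\rangle)}\ \ge\ L^{\sqrt{\mathrm{CE}}}(|\Psi\rangle)\ \ge\ \frac12\max_{\substack{i\neq j\in s\\ \hat a,\hat b\in S^2}}\big|Q^{ij}_{\hat a,\hat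 b}(|\Psi\rangle)\big| ,$$ where $S^2$ is the unit sphere of $\mathbb{R}^3$ and the maximum on the right is read as $0$ if $|s|=1$. Moreover, for all $i\neq j\in s$, the maximum $\max_{\hat a,\hat b\in S^2}|Q^{ij}_{\hat a,\hat b}(|\Psi\rangle)|$ exists and equals the largest singular value of $\mathbf Q^{ij}(|\Psi\rangle)$; hence, if $|s|\ge2$, the maximum on the right-hand side of the display exists and equals the largest singular value of $\mathbf Q^{ij}(|\Psi\rangle)$ for an optimal pair $i\neq j\in s$. -/

import Mathlib

noncomputable section

/-- The Hilbert space `⨂_{k ∈ κ} ℂ²` of a family of qubits labelled by `κ`, written in the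
computational basis (a basis vector is a bit assignment `κ → Fin 2`). -/
abbrev Qubits (κ : Type*) [Fintype κ] : Type _ := EuclideanSpace ℂ (κ → Fin 2)

section States

variable {κ : Type*} [Fintype κ] [DecidableEq κ]

/-- Glue a bit assignment on `γ` and one on the complement of `γ`. -/
def glue (γ : Finset κ) (x : {i // i ∈ γ} → Fin 2) (z : {i // i ∉ γ} → Fin 2) : κ → Fin 2 :=
  fun i => if h : i ∈ γ then x ⟨i, h⟩ else z ⟨i, h⟩

/-- The reduced state `ψ_γ` of `|ψ⟩⟨ψ|` on the qubits in `γ` (partial trace over the others). -/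
def reducedState (ψ : Qubits κ) (γ : Finset κ) :
    Matrix ({i // i ∈ γ} → Fin 2) ({i // i ∈ γ} → Fin 2) ℂ :=
  fun x x' => ∑ z : {i // i ∉ γ} → Fin 2, ψ (glue γ x z) * star (ψ (glue γ x' z))

/-- The purity `tr (ψ_γ ^ 2)`; the trace is real because `ψ_γ` is Hermitian. -/
def purity (ψ : Qubits κ) (γ : Finset κ) : ℝ := ((reducedState ψ γ) ^ 2).trace.re

/-- The concentratable entanglement `1 - 2 ^ (-|s|) ∑_{γ ⊆ s} tr (ψ_γ ^ 2)`. -/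
def concentratableEntanglement (s : Finset κ) (ψ : Qubits κ) : ℝ :=
  1 - (1 / 2 ^ s.card) * ∑ γ ∈ s.powerset, purity ψ γ

/-- The square root of the concentratable entanglement. -/
def sqrtCE (s : Finset κ) (ψ : Qubits κ) : ℝ := √(concentratableEntanglement s ψ)

/-- `f` is a product vector `⨂_k v_k`. -/
def IsProductVector (f : Qubits κ) : Prop :=
  ∃ v : κ → EuclideanSpace ℂ (Fin 2), ∀ x : κ → Fin 2, f x = ∏ k, v k (x k)

end States

section Localization

variable {κ : Type*} [Fintype κ] [DecidableEq κ]

/-- The unnormalized post-measurement vector `(⟨f|_A ⊗ I_B) |Ψ⟩` on the complement `B` of `A`. -/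
def postVector (A : Finset κ) (f : Qubits {i // i ∈ A}) (Ψ : Qubits κ) : Qubits {i // i ∉ A} :=
  WithLp.toLp 2 fun y => ∑ x : {i // i ∈ A} → Fin 2, star (f x) * Ψ (glue A x y)

/-- The average `∑_k p_k E(φ_k)` of `E` over the ensemble produced by the rank-one projective
measurement of `Ψ` on `A` in the orthonormal basis `e`:
`p_k = ‖(⟨e_k|_A ⊗ I_B) Ψ‖ ^ 2` and `φ_k` is the normalized post-measurement state. -/
def averageEntanglement (A : Finset κ) (E : Qubits {i // i ∉ A} → ℝ) (Ψ : Qubits κ)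
    (e : OrthonormalBasis ({i // i ∈ A} → Fin 2) ℂ (Qubits {i // i ∈ A})) : ℝ :=
  ∑ k, ‖postVector A (e k) Ψ‖ ^ 2 *
    E ((‖postVector A (e k) Ψ‖ : ℂ)⁻¹ • postVector A (e k) Ψ)

/-- The averages of `E` attained by the local measurements on `A`, that is, by the rank-one
projective measurements on `A` all of whose projectors have tensor product form. -/
def localAverages (A : Finset κ) (E : Qubits {i // i ∉ A} → ℝ) (Ψ : Qubits κ) : Set ℝ :=
  {r | ∃ e : OrthonormalBasis ({i // i ∈ A} → Fin 2) ℂ (Qubits {i // i ∈ A}),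
    (∀ k, IsProductVector (e k)) ∧ r = averageEntanglement A E Ψ e}

/-- The localizable multipartite entanglement `L^E(Ψ)` with measured systems `A`. -/
def localizableEntanglement (A : Finset κ) (E : Qubits {i // i ∉ A} → ℝ) (Ψ : Qubits κ) : ℝ :=
  sSup (localAverages A E Ψ)

end Localization

section Correlation

variable {κ : Type*} [Fintype κ] [DecidableEq κ]

/-- The Pauli matrices. -/
def pauli : Fin 3 → Matrix (Fin 2) (Fin 2) ℂ :=
  ![!![0, 1; 1, 0], !![0, -Complex.I; Complex.I, 0], !![1, 0; 0, -1]]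

/-- The spin observable `a · σ` of a single qubit. -/
def spin (a : EuclideanSpace ℝ (Fin 3)) : Matrix (Fin 2) (Fin 2) ℂ :=
  ∑ k, (a k : ℂ) • pauli k

/-- The tensor product `⨂_k M_k` of single-qubit operators. -/
def tensorOp (M : κ → Matrix (Fin 2) (Fin 2) ℂ) : Matrix (κ → Fin 2) (κ → Fin 2) ℂ :=
  fun x y => ∏ k, M k (x k) (y k)

/-- The expectation value `⟨Ψ| X |Ψ⟩` of a Hermitian operator `X`. -/
def expectation (Ψ : Qubits κ) (X : Matrix (κ → Fin 2) (κ → Fin 2) ℂ) : ℝ :=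
  (∑ x, star (Ψ x) * (X.mulVec (fun y => Ψ y)) x).re

/-- The connected two-point spin correlation function `Q^{ij}_{a,b}(Ψ)` (for `i ≠ j`). -/
def spinCorrelation (Ψ : Qubits κ) (i j : κ) (a b : EuclideanSpace ℝ (Fin 3)) : ℝ :=
  expectation Ψ (tensorOp (Function.update (Function.update (fun _ => 1) i (spin a)) j (spin b)))
    - expectation Ψ (tensorOp (Function.update (fun _ => 1) i (spin a)))
      * expectation Ψ (tensorOp (Function.update (fun _ => 1) j (spin b)))

/-- The `3 × 3` correlation matrix `(Q^{ij})_{pq} = Q^{ij}_{e_p,e_q}`. -/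
def correlationMatrix (Ψ : Qubits κ) (i j : κ) : Matrix (Fin 3) (Fin 3) ℝ :=
  fun p q => spinCorrelation Ψ i j (EuclideanSpace.single p 1) (EuclideanSpace.single q 1)

/-- The largest singular value of a real `3 × 3` matrix (singular values are listed in
decreasing order, starting from index `0`). -/
def maxSingularValue (M : Matrix (Fin 3) (Fin 3) ℝ) : ℝ :=
  (Matrix.toEuclideanLin M).singularValues 0

/-- The values `|Q^{ij}_{a,b}(Ψ)|` for fixed `i, j` and unit vectors `a, b`. -/
def pairCorrelations (Ψ : Qubits κ) (i j : κ) : Set ℝ :=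
  {r | ∃ a b : EuclideanSpace ℝ (Fin 3), ‖a‖ = 1 ∧ ‖b‖ = 1 ∧ r = |spinCorrelation Ψ i j a b|}

/-- The values `|Q^{ij}_{a,b}(Ψ)|` for distinct `i, j` in `s` and unit vectors `a, b`. -/
def allCorrelations (Ψ : Qubits κ) (s : Set κ) : Set ℝ :=
  {r | ∃ i ∈ s, ∃ j ∈ s, i ≠ j ∧ r ∈ pairCorrelations Ψ i j}

/-- The maximum of `|Q^{ij}_{a,b}(Ψ)|` over distinct `i, j` in `s` and unit vectors `a, b`
(zero if `s` has no two distinct elements). -/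
def maxCorrelation (Ψ : Qubits κ) (s : Set κ) : ℝ := sSup (allCorrelations Ψ s)

end Correlation

end

/-!
`CE` is monotone in `s`: with a second copy of the state, `1 - CE` is the expectation of
`∏_{i ∈ s} (1 + SWAP_i) / 2`, a product of commuting projections. For a single qubit it is half of
one minus the purity, and this linear entropy controls the covariance of a spin observable of that
qubit with any `±1`-valued observable of the others, so `|Q| / 2 ≤ √CE` for pure states.

To pass to the localized states, measure in a product basis in which every outcome leaves the
expectation of `a · σ` on qubit `i` unchanged. Finding it amounts to making all diagonal entries
of a traceless Hermitian operator vanish in a product basis, which is possible one qubit at a time.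
Then the average of `Q` over the outcomes is `Q(Ψ)` itself, since the product of the two means
becomes linear in the second one. The first inequality of the theorem is Jensen's, maxima over
product bases exist by compactness, and `Q` is bilinear in the directions, so its maximum over unit
vectors is the largest singular value of its matrix.
-/

section

open Matrix
open scoped ComplexOrder

section Expectation

variable {κ : Type*} [Fintype κ] [DecidableEq κ]

lemma expectation_eq_re_inner (ψ : Qubits κ) (X : Matrix (κ → Fin 2) (κ → Fin 2) ℂ) :
    expectation ψ X = (inner ℂ ψ (toEuclideanLin X ψ)).re := by
  rw [EuclideanSpace.inner_eq_star_dotProduct, dotProduct_comm]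
  rfl

lemma expectation_one (ψ : Qubits κ) : expectation ψ 1 = ‖ψ‖ ^ 2 := by
  rw [expectation_eq_re_inner, toLpLin_one, LinearMap.id_apply]
  exact inner_self_eq_norm_sq (𝕜 := ℂ) ψ

lemma expectation_add (ψ : Qubits κ) (X Y : Matrix (κ → Fin 2) (κ → Fin 2) ℂ) :
    expectation ψ (X + Y) = expectation ψ X + expectation ψ Y := by
  simp only [expectation_eq_re_inner, map_add, LinearMap.add_apply, inner_add_right,
    Complex.add_re]

lemma expectation_smul (ψ : Qubits κ) (c : ℝ) (X : Matrix (κ → Fin 2) (κ → Fin 2) ℂ) :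
    expectation ψ ((c : ℂ) • X) = c * expectation ψ X := by
  simp only [expectation_eq_re_inner, map_smul, LinearMap.smul_apply, inner_smul_right,
    Complex.re_ofReal_mul]

lemma expectation_smul_left (c : ℂ) (ψ : Qubits κ) (X : Matrix (κ → Fin 2) (κ → Fin 2) ℂ) :
    expectation (c • ψ) X = ‖c‖ ^ 2 * expectation ψ X := by
  rw [expectation_eq_re_inner, expectation_eq_re_inner, map_smul, inner_smul_left,
    inner_smul_right, ← mul_assoc, Complex.conj_mul', ← Complex.ofReal_pow, Complex.re_ofReal_mul]

lemma sum_expectation_orthonormalBasis {ι : Type*} [Fintype ι]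
    (e : OrthonormalBasis ι ℂ (Qubits κ)) (X : Matrix (κ → Fin 2) (κ → Fin 2) ℂ) :
    ∑ k, expectation (e k) X = X.trace.re := by
  simp only [expectation_eq_re_inner]
  rw [← Complex.re_sum, ← LinearMap.trace_eq_sum_inner]
  exact congrArg Complex.re (trace_toLin_eq X (PiLp.basisFun 2 ℂ _))

end Expectation

section RestrictUpdate

variable {κ β : Type*} [DecidableEq κ] {γ : Finset κ} (f : κ → β) (b : β)

lemma restrict_update (i : {i // i ∉ γ}) :
    (fun k : {k // k ∉ γ} => Function.update f i b k) =
      Function.update (fun k : {k // k ∉ γ} => f k) i b :=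
  Function.update_comp_eq_of_injective' f Subtype.val_injective i b

lemma restrict_update_of_mem {i : κ} (hi : i ∈ γ) :
    (fun k : {k // k ∉ γ} => Function.update f i b k) = fun k : {k // k ∉ γ} => f k :=
  Function.update_comp_eq_of_forall_ne' f b fun k h => k.2 (h ▸ hi)

end RestrictUpdate

section TensorOp

variable {κ : Type*} [Fintype κ]

lemma tensorOp_one : tensorOp (fun _ : κ => (1 : Matrix (Fin 2) (Fin 2) ℂ)) = 1 := by
  ext x y
  simp only [tensorOp, one_apply]
  rw [Finset.prod_ite_zero]
  simp [funext_iff]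

lemma tensorOp_mul [DecidableEq κ] (M M' : κ → Matrix (Fin 2) (Fin 2) ℂ) :
    tensorOp M * tensorOp M' = tensorOp fun k => M k * M' k := by
  ext x y
  simp only [mul_apply, tensorOp, ← Finset.prod_mul_distrib]
  exact (Fintype.prod_sum fun k t => M k (x k) t * M' k t (y k)).symm

lemma tensorOp_isHermitian {M : κ → Matrix (Fin 2) (Fin 2) ℂ}
    (hM : ∀ k, (M k).IsHermitian) : (tensorOp M).IsHermitian := by
  ext x y
  simp only [conjTranspose_apply, tensorOp, star_prod]
  exact Finset.prod_congr rfl fun k _ => (hM k).apply (x k) (y k)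

end TensorOp

section Glue

variable {κ : Type*} [DecidableEq κ]

@[simp] lemma glue_apply_mem (γ : Finset κ) (x : {i // i ∈ γ} → Fin 2)
    (z : {i // i ∉ γ} → Fin 2) (i : {i // i ∈ γ}) : glue γ x z i = x i := by
  simp [glue]

@[simp] lemma glue_apply_notMem (γ : Finset κ) (x : {i // i ∈ γ} → Fin 2)
    (z : {i // i ∉ γ} → Fin 2) (i : {i // i ∉ γ}) : glue γ x z i = z i := by
  simp [glue, i.2]

variable [Fintype κ]

lemma sum_glue {M : Type*} [AddCommMonoid M] (γ : Finset κ) (f : (κ → Fin 2) → M) :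
    ∑ w, f w = ∑ x : {i // i ∈ γ} → Fin 2, ∑ z : {i // i ∉ γ} → Fin 2, f (glue γ x z) := by
  rw [← Fintype.sum_prod_type']
  exact ((Equiv.piEquivPiSubtypeProd (· ∈ γ) fun _ => Fin 2).symm.sum_comp f).symm

lemma tensorOp_glue (M : κ → Matrix (Fin 2) (Fin 2) ℂ) (γ : Finset κ)
    (x x' : {i // i ∈ γ} → Fin 2) (z z' : {i // i ∉ γ} → Fin 2) :
    tensorOp M (glue γ x z) (glue γ x' z') =
      tensorOp (fun k : {i // i ∈ γ} => M k) x x' *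
        tensorOp (fun k : {i // i ∉ γ} => M k) z z' := by
  unfold tensorOp
  rw [← Fintype.prod_subtype_mul_prod_subtype (fun i => i ∈ γ)]
  simp only [glue_apply_mem, glue_apply_notMem]
  congr!

/-- The amplitudes of `ψ` as a matrix with rows indexed by the bits in `γ` and columns by the
remaining bits. -/
def coeffMatrix (γ : Finset κ) (ψ : Qubits κ) :
    Matrix ({i // i ∈ γ} → Fin 2) ({i // i ∉ γ} → Fin 2) ℂ :=
  of fun x z => ψ (glue γ x z)

/-- The partial trace of `(1 ⊗ T) |ψ⟩⟨ψ|` over the qubits outside `γ`, where `T` acts on those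
qubits: the reduced state weighted by the outcome of `T`. -/
def weightedReducedState (γ : Finset κ) (ψ : Qubits κ)
    (T : Matrix ({i // i ∉ γ} → Fin 2) ({i // i ∉ γ} → Fin 2) ℂ) :
    Matrix ({i // i ∈ γ} → Fin 2) ({i // i ∈ γ} → Fin 2) ℂ :=
  coeffMatrix γ ψ * Tᵀ * (coeffMatrix γ ψ)ᴴ

variable (γ : Finset κ) (ψ : Qubits κ)

lemma weightedReducedState_one : weightedReducedState γ ψ 1 = reducedState ψ γ := by
  rw [weightedReducedState, transpose_one, Matrix.mul_one]
  rfl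

lemma weightedReducedState_add (T T' : Matrix ({i // i ∉ γ} → Fin 2) ({i // i ∉ γ} → Fin 2) ℂ) :
    weightedReducedState γ ψ (T + T') =
      weightedReducedState γ ψ T + weightedReducedState γ ψ T' := by
  rw [weightedReducedState, transpose_add, Matrix.mul_add, Matrix.add_mul]
  rfl

lemma weightedReducedState_neg (T : Matrix ({i // i ∉ γ} → Fin 2) ({i // i ∉ γ} → Fin 2) ℂ) :
    weightedReducedState γ ψ (-T) = -weightedReducedState γ ψ T := by
  rw [weightedReducedState, transpose_neg, Matrix.mul_neg, Matrix.neg_mul]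
  rfl

lemma weightedReducedState_posSemidef
    {T : Matrix ({i // i ∉ γ} → Fin 2) ({i // i ∉ γ} → Fin 2) ℂ} (hT : T.PosSemidef) :
    (weightedReducedState γ ψ T).PosSemidef :=
  hT.transpose.mul_mul_conjTranspose_same _

lemma expectation_postVector (f : Qubits {i // i ∈ γ})
    (T : Matrix ({i // i ∉ γ} → Fin 2) ({i // i ∉ γ} → Fin 2) ℂ) :
    expectation (postVector γ f ψ) T = expectation f (weightedReducedState γ ψ T) := by
  have hpost : (postVector γ f ψ).ofLp = star f.ofLp ᵥ* coeffMatrix γ ψ := rfl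
  change (star (postVector γ f ψ).ofLp ⬝ᵥ T *ᵥ (postVector γ f ψ).ofLp).re =
    (star f.ofLp ⬝ᵥ weightedReducedState γ ψ T *ᵥ f.ofLp).re
  rw [weightedReducedState, ← mulVec_mulVec, ← mulVec_mulVec, dotProduct_mulVec, hpost,
    star_vecMul, star_star, mulVec_transpose, dotProduct_comm, dotProduct_mulVec, dotProduct_comm,
    dotProduct_comm]

lemma expectation_tensorOp (M : κ → Matrix (Fin 2) (Fin 2) ℂ) :
    expectation ψ (tensorOp M) =
      (tensorOp (fun k : {i // i ∈ γ} => M k) *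
        weightedReducedState γ ψ (tensorOp fun k : {i // i ∉ γ} => M k)).trace.re := by
  have hentry (x x') : weightedReducedState γ ψ (tensorOp fun k : {i // i ∉ γ} => M k) x' x =
      ∑ z, ∑ z', ψ (glue γ x' z') * tensorOp (fun k : {i // i ∉ γ} => M k) z z' *
        star (ψ (glue γ x z)) := by
    simp only [weightedReducedState, mul_apply, coeffMatrix, of_apply, transpose_apply,
      conjTranspose_apply, Finset.sum_mul]
  simp only [expectation, mulVec, dotProduct, sum_glue γ, tensorOp_glue, trace, diag_apply,
    mul_apply (M := tensorOp _), hentry, Finset.mul_sum]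
  refine congrArg Complex.re (Finset.sum_congr rfl fun x _ => ?_)
  rw [Finset.sum_comm]
  refine Finset.sum_congr rfl fun x' _ => Finset.sum_congr rfl fun z _ =>
    Finset.sum_congr rfl fun z' _ => ?_
  ring

lemma trace_reducedState : (reducedState ψ γ).trace = (‖ψ‖ : ℂ) ^ 2 := by
  have hre := expectation_tensorOp γ ψ fun _ => 1
  simp only [tensorOp_one, expectation_one, weightedReducedState_one, Matrix.one_mul] at hre
  have hpos := weightedReducedState_posSemidef γ ψ PosSemidef.one
  rw [weightedReducedState_one] at hpos
  rw [← Complex.ofReal_pow, hre]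
  exact Complex.eq_re_of_ofReal_le hpos.trace_nonneg

end Glue

section Swap

variable {κ : Type*} [DecidableEq κ]

/-- Exchange of the bits in `γ` between the two copies of a doubled register. -/
def swapBits (γ : Finset κ) : Equiv.Perm ((κ → Fin 2) × (κ → Fin 2)) :=
  Function.Involutive.toPerm (fun w => (γ.piecewise w.2 w.1, γ.piecewise w.1 w.2)) fun w => by
    ext k <;> by_cases hk : k ∈ γ <;> simp [hk]

lemma swapBits_apply (γ : Finset κ) (w : (κ → Fin 2) × (κ → Fin 2)) :
    swapBits γ w = (γ.piecewise w.2 w.1, γ.piecewise w.1 w.2) := rfl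

lemma swapBits_symm (γ : Finset κ) : (swapBits γ).symm = swapBits γ :=
  Function.Involutive.toPerm_symm _

lemma swapBits_empty : swapBits (∅ : Finset κ) = 1 := by
  ext w k <;> simp [swapBits_apply]

lemma swapBits_apply_swapBits_apply (γ δ : Finset κ) (w : (κ → Fin 2) × (κ → Fin 2)) :
    swapBits γ (swapBits δ w) = swapBits (symmDiff γ δ) w := by
  ext k <;> by_cases hγ : k ∈ γ <;> by_cases hδ : k ∈ δ <;>
    simp [swapBits_apply, Finset.mem_symmDiff, hγ, hδ]

variable [Fintype κ]

/-- The state space of two copies of the qubits labelled by `κ`. -/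
abbrev DoubledQubits (κ : Type*) : Type _ :=
  EuclideanSpace ℂ ((κ → Fin 2) × (κ → Fin 2))

/-- The unitary that exchanges the qubits in `γ` between the two copies. -/
noncomputable def swapUnitary (γ : Finset κ) : DoubledQubits κ ≃ₗᵢ[ℂ] DoubledQubits κ :=
  LinearIsometryEquiv.piLpCongrLeft 2 ℂ ℂ (swapBits γ)

lemma swapUnitary_apply (γ : Finset κ) (ξ : DoubledQubits κ) (w : (κ → Fin 2) × (κ → Fin 2)) :
    swapUnitary γ ξ w = ξ (swapBits γ w) := by
  rw [swapUnitary, LinearIsometryEquiv.piLpCongrLeft_apply]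
  change ξ ((swapBits γ).symm w) = _
  rw [swapBits_symm]

lemma swapUnitary_empty (ξ : DoubledQubits κ) : swapUnitary ∅ ξ = ξ := by
  ext w
  rw [swapUnitary_apply, swapBits_empty, Equiv.Perm.one_apply]

lemma swapUnitary_apply_swapUnitary_apply (γ δ : Finset κ) (ξ : DoubledQubits κ) :
    swapUnitary γ (swapUnitary δ ξ) = swapUnitary (symmDiff γ δ) ξ := by
  ext w
  simp only [swapUnitary_apply, swapBits_apply_swapBits_apply, symmDiff_comm]

lemma inner_swapUnitary_left (γ : Finset κ) (ξ η : DoubledQubits κ) :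
    inner ℂ (swapUnitary γ ξ) η = inner ℂ ξ (swapUnitary γ η) := by
  rw [← (swapUnitary γ).inner_map_map, swapUnitary_apply_swapUnitary_apply, symmDiff_self,
    Finset.bot_eq_empty, swapUnitary_empty]

/-- The quadratic form of the operator `∑_{γ ⊆ s} F_γ = ∏_{i ∈ s} (1 + F_i)`, where `F_γ`
exchanges the qubits in `γ` between the two copies. -/
noncomputable def swapForm (s : Finset κ) (ξ : DoubledQubits κ) : ℝ :=
  ∑ γ ∈ s.powerset, (inner ℂ ξ (swapUnitary γ ξ)).re

variable {s : Finset κ} {i : κ}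

lemma swapForm_insert (hi : i ∉ s) (ξ : DoubledQubits κ) :
    swapForm (insert i s) ξ =
      swapForm s ξ + ∑ γ ∈ s.powerset, (inner ℂ ξ (swapUnitary (symmDiff γ {i}) ξ)).re := by
  rw [swapForm, Finset.sum_powerset_insert hi, swapForm]
  refine congrArg _ (Finset.sum_congr rfl fun γ hγ => ?_)
  have hiγ : i ∉ γ := fun h => hi (Finset.mem_powerset.1 hγ h)
  rw [(Finset.disjoint_singleton_right.2 hiγ).symmDiff_eq_sup, Finset.sup_eq_union,
    Finset.union_comm, Finset.insert_eq]

lemma swapForm_add_swapUnitary (hi : i ∉ s) (ξ : DoubledQubits κ) :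
    swapForm s (ξ + swapUnitary {i} ξ) = 2 * swapForm (insert i s) ξ := by
  rw [swapForm_insert hi, swapForm, swapForm, ← Finset.sum_add_distrib, Finset.mul_sum]
  refine Finset.sum_congr rfl fun γ _ => ?_
  simp only [map_add, inner_add_left, inner_add_right, inner_swapUnitary_left,
    swapUnitary_apply_swapUnitary_apply, symmDiff_comm {i}, symmDiff_symmDiff_cancel_right,
    Complex.add_re]
  ring

lemma swapForm_sub_swapUnitary (hi : i ∉ s) (ξ : DoubledQubits κ) :
    swapForm s (ξ - swapUnitary {i} ξ) = 4 * swapForm s ξ - 2 * swapForm (insert i s) ξ := by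
  rw [← swapForm_add_swapUnitary hi, swapForm, swapForm, swapForm, Finset.mul_sum,
    ← Finset.sum_sub_distrib]
  refine Finset.sum_congr rfl fun γ _ => ?_
  simp only [map_add, map_sub, inner_add_left, inner_add_right, inner_sub_left, inner_sub_right,
    inner_swapUnitary_left, swapUnitary_apply_swapUnitary_apply, symmDiff_comm {i},
    symmDiff_symmDiff_cancel_right, Complex.add_re, Complex.sub_re]
  ring

lemma swapForm_nonneg (s : Finset κ) (ξ : DoubledQubits κ) : 0 ≤ swapForm s ξ := by
  induction s using Finset.induction_on generalizing ξ with
  | empty =>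
    rw [swapForm, Finset.powerset_empty, Finset.sum_singleton, swapUnitary_empty]
    exact inner_self_nonneg (𝕜 := ℂ)
  | insert i s hi ih =>
    linarith [ih (ξ + swapUnitary {i} ξ), swapForm_add_swapUnitary hi ξ]

lemma swapForm_insert_le (hi : i ∉ s) (ξ : DoubledQubits κ) :
    swapForm (insert i s) ξ ≤ 2 * swapForm s ξ := by
  linarith [swapForm_nonneg s (ξ - swapUnitary {i} ξ), swapForm_sub_swapUnitary hi ξ]

/-- The two-copy state `ψ ⊗ ψ`. -/
noncomputable def twoCopies (ψ : Qubits κ) : DoubledQubits κ :=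
  WithLp.toLp 2 fun w => ψ w.1 * ψ w.2

lemma purity_eq_re_inner (ψ : Qubits κ) (γ : Finset κ) :
    purity ψ γ = (inner ℂ (twoCopies ψ) (swapUnitary γ (twoCopies ψ))).re := by
  have hswap (x x' : {k // k ∈ γ} → Fin 2) (z z' : {k // k ∉ γ} → Fin 2) :
      swapBits γ (glue γ x z, glue γ x' z') = (glue γ x' z, glue γ x z') := by
    ext k <;> by_cases hk : k ∈ γ <;> simp [swapBits_apply, glue, hk]
  rw [← inner_swapUnitary_left, PiLp.inner_apply, Fintype.sum_prod_type, sum_glue γ]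
  simp only [sum_glue γ (fun y => inner ℂ _ (twoCopies ψ (_, y))), swapUnitary_apply, hswap]
  simp only [purity, pow_two, trace, diag_apply, mul_apply, reducedState, twoCopies,
    RCLike.inner_apply']
  refine congrArg Complex.re (Finset.sum_congr rfl fun x _ => ?_)
  rw [Finset.sum_comm]
  refine Finset.sum_congr rfl fun x' _ => ?_
  rw [Finset.sum_mul_sum]
  refine Finset.sum_congr rfl fun z _ => Finset.sum_congr rfl fun z' _ => ?_
  simp only [map_mul, RCLike.star_def]
  ring

lemma concentratableEntanglement_eq_swapForm (s : Finset κ) (ψ : Qubits κ) :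
    concentratableEntanglement s ψ = 1 - 1 / 2 ^ s.card * swapForm s (twoCopies ψ) := by
  simp only [concentratableEntanglement, swapForm, purity_eq_re_inner]

theorem concentratableEntanglement_mono (ψ : Qubits κ) :
    Monotone fun s => concentratableEntanglement s ψ := by
  refine Finset.monotone_iff_forall_le_insert.2 fun s i hi => ?_
  simp only [concentratableEntanglement_eq_swapForm, Finset.card_insert_of_notMem hi]
  have h : 1 / 2 ^ (s.card + 1) * swapForm (insert i s) (twoCopies ψ) ≤
      1 / 2 ^ (s.card + 1) * (2 * swapForm s (twoCopies ψ)) := by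
    gcongr
    exact swapForm_insert_le hi _
  calc 1 - 1 / 2 ^ s.card * swapForm s (twoCopies ψ)
      = 1 - 1 / 2 ^ (s.card + 1) * (2 * swapForm s (twoCopies ψ)) := by
        rw [pow_succ]; field_simp
    _ ≤ 1 - 1 / 2 ^ (s.card + 1) * swapForm (insert i s) (twoCopies ψ) := by linarith

lemma purity_empty (ψ : Qubits κ) : purity ψ ∅ = ‖ψ‖ ^ 4 := by
  have hnorm : ‖twoCopies ψ‖ ^ 2 = (‖ψ‖ ^ 2) ^ 2 := by
    simp only [EuclideanSpace.norm_sq_eq, twoCopies, norm_mul, mul_pow, Fintype.sum_prod_type,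
      ← Finset.sum_mul_sum, ← pow_two]
  rw [purity_eq_re_inner, swapUnitary_empty]
  refine (inner_self_eq_norm_sq (𝕜 := ℂ) _).trans ?_
  rw [hnorm, ← pow_mul]

lemma concentratableEntanglement_nonneg (s : Finset κ) {ψ : Qubits κ} (hψ : ‖ψ‖ = 1) :
    0 ≤ concentratableEntanglement s ψ := by
  refine le_trans (le_of_eq ?_) (concentratableEntanglement_mono ψ s.empty_subset)
  simp [concentratableEntanglement, purity_empty, hψ]

lemma concentratableEntanglement_singleton (i : κ) {ψ : Qubits κ} (hψ : ‖ψ‖ = 1) :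
    concentratableEntanglement {i} ψ = (1 - purity ψ {i}) / 2 := by
  rw [concentratableEntanglement, ← LawfulSingleton.insert_empty_eq,
    Finset.sum_powerset_insert (Finset.notMem_empty i)]
  simp only [Finset.powerset_empty, Finset.sum_singleton, purity_empty, hψ]
  simp only [insert_empty_eq, Finset.card_singleton]
  ring

end Swap

section PosSemidefPair

-- The hypotheses hold for the entries of `ρ = !![p, g; star g, q]` and `W = !![α, h; star h, β]`
-- when `ρ + W` and `ρ - W` are positive semidefinite.
lemma sq_mul_sub_mul_le {E : Type*} [NormedAddCommGroup E] [InnerProductSpace ℝ E] {g h : E}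
    {p q α β : ℝ} (hα : |α| ≤ p) (hβ : |β| ≤ q) (hg : ‖g‖ ^ 2 ≤ p * q)
    (hadd : ‖g + h‖ ^ 2 ≤ (p + α) * (q + β)) (hsub : ‖g - h‖ ^ 2 ≤ (p - α) * (q - β)) :
    (q * α - p * β) ^ 2 ≤ 4 * (p * q) * (p * q - ‖g‖ ^ 2) := by
  rw [norm_add_sq_real] at hadd
  rw [norm_sub_sq_real] at hsub
  set r : ℝ := inner ℝ g h
  set s : ℝ := q * α + p * β
  have hp : 0 ≤ p := (abs_nonneg α).trans hα
  have hq : 0 ≤ q := (abs_nonneg β).trans hβ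
  have hαβ : |α * β| ≤ p * q := by rw [abs_mul]; gcongr
  have hs : |s| ≤ 2 * (p * q) := by
    calc |s| ≤ |q * α| + |p * β| := abs_add_le _ _
      _ = q * |α| + p * |β| := by rw [abs_mul, abs_mul, abs_of_nonneg hp, abs_of_nonneg hq]
      _ ≤ q * p + p * q := by gcongr
      _ = 2 * (p * q) := by ring
  have hr : |r| ≤ ‖g‖ * ‖h‖ := abs_real_inner_le_norm g h
  have hgap : ‖h‖ ^ 2 + |s - 2 * r| ≤ p * q + α * β - ‖g‖ ^ 2 := by
    cases abs_cases (s - 2 * r) <;> linarith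
  have hsum : |s + 2 * r| ≤ 4 * (p * q) := by
    have h2r : 2 * |r| ≤ 2 * (p * q) := by
      linarith [two_mul_le_add_sq ‖g‖ ‖h‖, le_of_abs_le hαβ, abs_nonneg (s - 2 * r)]
    calc |s + 2 * r| ≤ |s| + |2 * r| := abs_add_le _ _
      _ ≤ 4 * (p * q) := by rw [abs_mul, abs_two]; linarith
  have hs_sq : s ^ 2 ≤ 4 * (p * q) * (p * q + α * β - ‖g‖ ^ 2) := by
    calc s ^ 2 = 4 * |r| ^ 2 + (s + 2 * r) * (s - 2 * r) := by rw [sq_abs]; ring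
      _ ≤ 4 * (‖g‖ * ‖h‖) ^ 2 + |s + 2 * r| * |s - 2 * r| := by
        rw [← abs_mul]; gcongr; exact le_abs_self _
      _ ≤ 4 * ((p * q) * ‖h‖ ^ 2) + 4 * (p * q) * |s - 2 * r| := by rw [mul_pow]; gcongr
      _ = 4 * (p * q) * (‖h‖ ^ 2 + |s - 2 * r|) := by ring
      _ ≤ 4 * (p * q) * (p * q + α * β - ‖g‖ ^ 2) := by gcongr
  calc (q * α - p * β) ^ 2 = s ^ 2 - 4 * (p * q) * (α * β) := by ring
    _ ≤ 4 * (p * q) * (p * q + α * β - ‖g‖ ^ 2) - 4 * (p * q) * (α * β) := by gcongr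
    _ = 4 * (p * q) * (p * q - ‖g‖ ^ 2) := by ring

lemma det_re_fin_two_of_isHermitian {M : Matrix (Fin 2) (Fin 2) ℂ} (hM : M.IsHermitian) :
    M.det.re = (M 0 0).re * (M 1 1).re - ‖M 0 1‖ ^ 2 := by
  have him : (M 0 0).im = 0 := Complex.conj_eq_iff_im.1 (hM.apply 0 0)
  rw [det_fin_two, ← hM.apply 1 0, Complex.sub_re, Complex.mul_re, him, zero_mul, sub_zero,
    RCLike.star_def, Complex.mul_conj', ← Complex.ofReal_pow, Complex.ofReal_re]

lemma norm_sq_le_of_posSemidef_fin_two {M : Matrix (Fin 2) (Fin 2) ℂ} (hM : M.PosSemidef) :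
    ‖M 0 1‖ ^ 2 ≤ (M 0 0).re * (M 1 1).re := by
  rw [← sub_nonneg, ← det_re_fin_two_of_isHermitian hM.isHermitian]
  exact (Complex.nonneg_iff.1 hM.det_nonneg).1

lemma posSemidef_of_add_of_sub {n : Type*} {ρ W : Matrix n n ℂ}
    (hadd : (ρ + W).PosSemidef) (hsub : (ρ - W).PosSemidef) : ρ.PosSemidef := by
  have h : ρ = (2⁻¹ : ℝ) • (ρ + W + (ρ - W)) := by
    rw [add_add_sub_cancel, ← two_smul ℝ, smul_smul, inv_mul_cancel₀ two_ne_zero, one_smul]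
  rw [h]
  exact (hadd.add hsub).smul (by positivity)

theorem sq_diag_covariance_le_of_posSemidef {ρ W : Matrix (Fin 2) (Fin 2) ℂ}
    (hadd : (ρ + W).PosSemidef) (hsub : (ρ - W).PosSemidef) :
    ((ρ 1 1).re * (W 0 0).re - (ρ 0 0).re * (W 1 1).re) ^ 2 ≤
      4 * ((ρ 0 0).re * (ρ 1 1).re) * ρ.det.re := by
  have hρ := posSemidef_of_add_of_sub hadd hsub
  have hdiag (k : Fin 2) : |(W k k).re| ≤ (ρ k k).re := by
    have h₁ := (Complex.nonneg_iff.1 (hadd.diag_nonneg (i := k))).1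
    have h₂ := (Complex.nonneg_iff.1 (hsub.diag_nonneg (i := k))).1
    rw [Matrix.add_apply, Complex.add_re] at h₁
    rw [Matrix.sub_apply, Complex.sub_re] at h₂
    exact abs_le.2 ⟨by linarith, by linarith⟩
  rw [det_re_fin_two_of_isHermitian hρ.isHermitian]
  exact sq_mul_sub_mul_le (hdiag 0) (hdiag 1) (norm_sq_le_of_posSemidef_fin_two hρ)
    (norm_sq_le_of_posSemidef_fin_two hadd) (norm_sq_le_of_posSemidef_fin_two hsub)

lemma trace_mul_eq_sum_eigenvalues_mul {n : Type*} [Fintype n] [DecidableEq n]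
    {X : Matrix n n ℂ} (hX : X.IsHermitian) (M : Matrix n n ℂ) :
    (X * M).trace = ∑ k, (hX.eigenvalues k : ℂ) *
      ((hX.eigenvectorUnitary : Matrix n n ℂ)ᴴ * M * hX.eigenvectorUnitary) k k := by
  set U := (hX.eigenvectorUnitary : Matrix n n ℂ)
  have hspec : X = U * diagonal (fun k => (hX.eigenvalues k : ℂ)) * Uᴴ := hX.spectral_theorem
  calc (X * M).trace
      = (U * (diagonal (fun k => (hX.eigenvalues k : ℂ)) * (Uᴴ * M))).trace := by
        simp only [← Matrix.mul_assoc, ← hspec]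
    _ = (diagonal (fun k => (hX.eigenvalues k : ℂ)) * (Uᴴ * M * U)).trace := by
        rw [trace_mul_comm, Matrix.mul_assoc]
    _ = _ := by simp only [trace, diag_apply, diagonal_mul]

lemma discr_re_fin_two_of_isHermitian {X : Matrix (Fin 2) (Fin 2) ℂ} (hX : X.IsHermitian) :
    X.discr.re = (hX.eigenvalues 0 - hX.eigenvalues 1) ^ 2 := by
  rw [discr_fin_two, hX.trace_eq_sum_eigenvalues, hX.det_eq_prod_eigenvalues,
    Fin.sum_univ_two, Fin.prod_univ_two]
  simp only [Complex.coe_algebraMap, ← Complex.ofReal_add, ← Complex.ofReal_mul]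
  norm_cast
  ring

theorem sq_trace_covariance_le {ρ W X : Matrix (Fin 2) (Fin 2) ℂ} (hX : X.IsHermitian)
    (hadd : (ρ + W).PosSemidef) (hsub : (ρ - W).PosSemidef) (hρ : ρ.trace = 1) :
    ((X * W).trace.re - (X * ρ).trace.re * W.trace.re) ^ 2 ≤ X.discr.re * ρ.det.re := by
  set U := (hX.eigenvectorUnitary : Matrix (Fin 2) (Fin 2) ℂ) with hU
  have hUU : U * Uᴴ = 1 := mem_unitaryGroup_iff.1 hX.eigenvectorUnitary.2
  have hUU' : Uᴴ * U = 1 := mem_unitaryGroup_iff'.1 hX.eigenvectorUnitary.2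
  have htrace (M : Matrix (Fin 2) (Fin 2) ℂ) : M.trace = (Uᴴ * M * U).trace := by
    rw [trace_mul_cycle, hUU, Matrix.one_mul]
  have hsq := sq_diag_covariance_le_of_posSemidef (ρ := Uᴴ * ρ * U) (W := Uᴴ * W * U)
    (by rw [← Matrix.add_mul, ← Matrix.mul_add]; exact hadd.conjTranspose_mul_mul_same U)
    (by rw [← Matrix.sub_mul, ← Matrix.mul_sub]; exact hsub.conjTranspose_mul_mul_same U)
  rw [det_mul_right_comm, hUU', Matrix.one_mul] at hsq
  have hone : ((Uᴴ * ρ * U) 0 0).re + ((Uᴴ * ρ * U) 1 1).re = 1 := by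
    rw [← Complex.add_re, ← trace_fin_two, ← htrace, hρ, Complex.one_re]
  rw [discr_re_fin_two_of_isHermitian hX, htrace W]
  simp only [trace_mul_eq_sum_eigenvalues_mul hX, trace_fin_two, Fin.sum_univ_two,
    Complex.add_re, Complex.re_ofReal_mul, ← hU]
  set μ := hX.eigenvalues
  set p := ((Uᴴ * ρ * U) 0 0).re
  set q := ((Uᴴ * ρ * U) 1 1).re
  set α := ((Uᴴ * W * U) 0 0).re
  set β := ((Uᴴ * W * U) 1 1).re
  have hdet : 0 ≤ ρ.det.re :=
    (Complex.nonneg_iff.1 (posSemidef_of_add_of_sub hadd hsub).det_nonneg).1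
  have hpq : 4 * (p * q) ≤ 1 := by nlinarith [sq_nonneg (p - q)]
  calc (μ 0 * α + μ 1 * β - (μ 0 * p + μ 1 * q) * (α + β)) ^ 2
      = (μ 0 - μ 1) ^ 2 * (q * α - p * β) ^ 2 := by
        rw [eq_sub_of_add_eq' hone]; ring
    _ ≤ (μ 0 - μ 1) ^ 2 * (4 * (p * q) * ρ.det.re) := by gcongr
    _ ≤ (μ 0 - μ 1) ^ 2 * (1 * ρ.det.re) := by gcongr
    _ = (μ 0 - μ 1) ^ 2 * ρ.det.re := by rw [one_mul]

lemma one_sub_trace_sq_fin_two {ρ : Matrix (Fin 2) (Fin 2) ℂ} (hρ : ρ.trace = 1) :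
    1 - (ρ ^ 2).trace = 2 * ρ.det := by
  rw [trace_fin_two] at hρ
  rw [det_fin_two, pow_two, trace_fin_two, mul_apply, mul_apply, Fin.sum_univ_two,
    Fin.sum_univ_two]
  linear_combination -(1 + ρ 0 0 + ρ 1 1) * hρ

lemma posSemidef_one_add_of_mul_self {n : Type*} [Fintype n] [DecidableEq n] {T : Matrix n n ℂ}
    (hT : T.IsHermitian) (hT2 : T * T = 1) : (1 + T).PosSemidef := by
  have h : 1 + T = (2⁻¹ : ℝ) • ((1 + T)ᴴ * (1 + T)) := by
    rw [conjTranspose_add, conjTranspose_one, hT.eq, Matrix.add_mul, Matrix.mul_add T, hT2,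
      Matrix.one_mul, Matrix.mul_one, add_comm T 1, ← two_smul ℝ, smul_smul,
      inv_mul_cancel₀ two_ne_zero, one_smul]
  rw [h]
  exact (posSemidef_conjTranspose_mul_self _).smul (by positivity)

end PosSemidefPair

section Spin

lemma spin_eq (a : EuclideanSpace ℝ (Fin 3)) :
    spin a = !![(a 2 : ℂ), a 0 - a 1 * Complex.I; a 0 + a 1 * Complex.I, -a 2] := by
  ext t t'
  fin_cases t <;> fin_cases t' <;> simp [spin, pauli, Fin.sum_univ_three]; ring

lemma isHermitian_spin (a : EuclideanSpace ℝ (Fin 3)) : (spin a).IsHermitian := by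
  rw [spin_eq]
  ext t t'
  fin_cases t <;> fin_cases t' <;> simp [conjTranspose_apply, ← sub_eq_add_neg]

lemma trace_spin (a : EuclideanSpace ℝ (Fin 3)) : (spin a).trace = 0 := by
  rw [spin_eq, trace_fin_two_of, add_neg_cancel]

lemma det_spin (a : EuclideanSpace ℝ (Fin 3)) : (spin a).det = -(‖a‖ : ℂ) ^ 2 := by
  rw [← Complex.ofReal_pow, EuclideanSpace.real_norm_sq_eq, Fin.sum_univ_three, spin_eq,
    det_fin_two_of]
  push_cast
  linear_combination (a 1 : ℂ) ^ 2 * Complex.I_sq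

lemma spin_mul_self (a : EuclideanSpace ℝ (Fin 3)) : spin a * spin a = (‖a‖ : ℂ) ^ 2 • 1 := by
  have h := aeval_self_charpoly (spin a)
  rw [charpoly_fin_two, trace_spin, det_spin] at h
  simpa [pow_two, Algebra.algebraMap_eq_smul_one, ← sub_eq_add_neg, sub_eq_zero, mul_smul] using h

end Spin

section PureStateBound

variable {κ : Type*}

/-- A bit as a bit assignment on the single qubit `i`. -/
def singleBitEquiv (i : κ) : Fin 2 ≃ ({k // k ∈ ({i} : Finset κ)} → Fin 2) :=
  (Equiv.funUnique _ _).symm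

lemma tensorOp_submatrix_singleBitEquiv (i : κ) (M : κ → Matrix (Fin 2) (Fin 2) ℂ) :
    (tensorOp fun k : {k // k ∈ ({i} : Finset κ)} => M k).submatrix (singleBitEquiv i)
      (singleBitEquiv i) = M i := by
  ext t t'
  simp [tensorOp, singleBitEquiv]

variable [Fintype κ] [DecidableEq κ]

/-- The state of the qubit `i` weighted by the outcome of `T` on the other qubits, as a `2 × 2`
matrix. -/
noncomputable def qubitState (i : κ) (φ : Qubits κ)
    (T : Matrix ({k // k ∉ ({i} : Finset κ)} → Fin 2) ({k // k ∉ ({i} : Finset κ)} → Fin 2) ℂ) :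
    Matrix (Fin 2) (Fin 2) ℂ :=
  (weightedReducedState {i} φ T).submatrix (singleBitEquiv i) (singleBitEquiv i)

variable (i : κ) (φ : Qubits κ)

lemma expectation_tensorOp_eq_trace_qubitState (M : κ → Matrix (Fin 2) (Fin 2) ℂ) :
    expectation φ (tensorOp M) =
      (M i * qubitState i φ (tensorOp fun k : {k // k ∉ ({i} : Finset κ)} => M k)).trace.re := by
  rw [expectation_tensorOp {i}, ← tensorOp_submatrix_singleBitEquiv i M, qubitState,
    submatrix_mul_equiv]
  exact congrArg Complex.re ((singleBitEquiv i).sum_comp fun x => diag _ x).symm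

lemma qubitState_one_add_posSemidef
    {T : Matrix ({k // k ∉ ({i} : Finset κ)} → Fin 2) ({k // k ∉ ({i} : Finset κ)} → Fin 2) ℂ}
    (hT : T.IsHermitian) (hT2 : T * T = 1) :
    (qubitState i φ 1 + qubitState i φ T).PosSemidef := by
  have h := weightedReducedState_posSemidef {i} φ (posSemidef_one_add_of_mul_self hT hT2)
  rw [weightedReducedState_add] at h
  exact h.submatrix (singleBitEquiv i)

lemma qubitState_neg
    (T : Matrix ({k // k ∉ ({i} : Finset κ)} → Fin 2) ({k // k ∉ ({i} : Finset κ)} → Fin 2) ℂ) :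
    qubitState i φ (-T) = -qubitState i φ T := by
  rw [qubitState, weightedReducedState_neg]
  rfl

lemma trace_qubitState_one : (qubitState i φ 1).trace = (‖φ‖ : ℂ) ^ 2 := by
  rw [qubitState, weightedReducedState_one, ← trace_reducedState {i}]
  exact (singleBitEquiv i).sum_comp fun x => diag (reducedState φ {i}) x

lemma purity_singleton : purity φ {i} = (qubitState i φ 1 ^ 2).trace.re := by
  rw [purity, qubitState, weightedReducedState_one, pow_two, pow_two, submatrix_mul_equiv]
  exact congrArg Complex.re ((singleBitEquiv i).sum_comp fun x => diag _ x).symm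

lemma two_mul_det_qubitState_one {φ : Qubits κ} (hφ : ‖φ‖ = 1) :
    2 * (qubitState i φ 1).det.re = 1 - purity φ {i} := by
  have h := congrArg Complex.re (one_sub_trace_sq_fin_two (ρ := qubitState i φ 1)
    (by rw [trace_qubitState_one, hφ]; norm_num))
  rw [purity_singleton]
  simpa using h.symm

lemma spinCorrelation_eq_trace_qubitState (j : {k // k ∉ ({i} : Finset κ)})
    (a b : EuclideanSpace ℝ (Fin 3)) :
    spinCorrelation φ i j a b =
      (spin a * qubitState i φ (tensorOp (Function.update 1 j (spin b)))).trace.re -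
        (spin a * qubitState i φ 1).trace.re *
          (qubitState i φ (tensorOp (Function.update 1 j (spin b)))).trace.re := by
  have hij : i ≠ j := fun h => j.2 (Finset.mem_singleton.2 h.symm)
  simp only [spinCorrelation, expectation_tensorOp_eq_trace_qubitState i, restrict_update,
    restrict_update_of_mem _ _ (Finset.mem_singleton_self i), Function.update_of_ne hij,
    Function.update_self, tensorOp_one, Matrix.one_mul]
  rfl

theorem spinCorrelation_sq_le {φ : Qubits κ} (hφ : ‖φ‖ = 1) {i j : κ} (hij : i ≠ j)
    {a b : EuclideanSpace ℝ (Fin 3)} (ha : ‖a‖ = 1) (hb : ‖b‖ = 1) :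
    spinCorrelation φ i j a b ^ 2 ≤ 2 * (1 - purity φ {i}) := by
  lift j to {k // k ∉ ({i} : Finset κ)} using fun h => hij (Finset.mem_singleton.1 h).symm
  set T := tensorOp (Function.update 1 j (spin b))
  have hT : T.IsHermitian := tensorOp_isHermitian fun k => by
    obtain rfl | hk := eq_or_ne k j
    · simpa using isHermitian_spin b
    · simp [hk]
  have hT2 : T * T = 1 := by
    rw [tensorOp_mul, ← tensorOp_one]
    congr with k : 1
    obtain rfl | hk := eq_or_ne k j
    · simp [spin_mul_self, hb]
    · simp [hk]
  have hdiscr : (spin a).discr.re = 4 := by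
    simp [discr_fin_two, trace_spin, det_spin, ha]
  rw [spinCorrelation_eq_trace_qubitState, ← two_mul_det_qubitState_one i hφ]
  have hbound := sq_trace_covariance_le (isHermitian_spin a)
    (qubitState_one_add_posSemidef i φ hT hT2)
    (by simpa [qubitState_neg, ← sub_eq_add_neg] using
      qubitState_one_add_posSemidef i φ hT.neg (by rw [neg_mul_neg, hT2]))
    (by rw [trace_qubitState_one, hφ]; norm_num)
  rw [hdiscr] at hbound
  linarith

lemma half_abs_spinCorrelation_le_sqrtCE {φ : Qubits κ} (hφ : ‖φ‖ = 1) {i j : κ} (hij : i ≠ j)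
    {a b : EuclideanSpace ℝ (Fin 3)} (ha : ‖a‖ = 1) (hb : ‖b‖ = 1) {s : Finset κ} (hi : i ∈ s) :
    1 / 2 * |spinCorrelation φ i j a b| ≤ sqrtCE s φ := by
  refine Real.le_sqrt_of_sq_le ?_
  rw [mul_pow, sq_abs]
  have hmono := concentratableEntanglement_mono φ (Finset.singleton_subset_iff.2 hi)
  simp only [concentratableEntanglement_singleton i hφ] at hmono
  linarith [spinCorrelation_sq_le hφ hij ha hb]

end PureStateBound

section ZeroExpectation

variable {κ : Type*} [Fintype κ] [DecidableEq κ]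

lemma continuous_expectation (X : Matrix (κ → Fin 2) (κ → Fin 2) ℂ) :
    Continuous fun ψ : Qubits κ => expectation ψ X := by
  simp only [expectation, mulVec, dotProduct]
  fun_prop

lemma exists_norm_eq_one_expectation_eq_zero {X : Matrix (κ → Fin 2) (κ → Fin 2) ℂ}
    (hX : X.trace.re = 0) : ∃ ψ : Qubits κ, ‖ψ‖ = 1 ∧ expectation ψ X = 0 := by
  let e := EuclideanSpace.basisFun (κ → Fin 2) ℂ
  have hsum : ∑ k, expectation (e k) X = ∑ _ : κ → Fin 2, (0 : ℝ) := by
    rw [sum_expectation_orthonormalBasis, hX, Finset.sum_const_zero]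
  obtain ⟨k, -, hk⟩ := Finset.exists_le_of_sum_le Finset.univ_nonempty hsum.le
  obtain ⟨l, -, hl⟩ := Finset.exists_le_of_sum_le Finset.univ_nonempty hsum.ge
  have hrank : 1 < Module.rank ℝ (Qubits κ) := by
    rw [rank_real_of_complex, ← Module.finrank_eq_rank, finrank_euclideanSpace]
    exact_mod_cast (by have := Fintype.card_pos (α := κ → Fin 2); omega :
      1 < 2 * Fintype.card (κ → Fin 2))
  have hmem (k) : e k ∈ Metric.sphere 0 1 := by simp
  obtain ⟨ψ, hψ, hψX⟩ := (isPreconnected_sphere hrank 0 1).intermediate_value (hmem k) (hmem l)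
    (continuous_expectation X).continuousOn ⟨hk, hl⟩
  exact ⟨ψ, mem_sphere_zero_iff_norm.1 hψ, hψX⟩

lemma exists_orthonormalBasis_expectation_eq_zero_of_unique [Unique κ]
    {X : Matrix (κ → Fin 2) (κ → Fin 2) ℂ} (hX : X.trace.re = 0) :
    ∃ e : OrthonormalBasis (κ → Fin 2) ℂ (Qubits κ), ∀ k, expectation (e k) X = 0 := by
  obtain ⟨ψ, hψ, hψX⟩ := exists_norm_eq_one_expectation_eq_zero hX
  let c := (Equiv.funUnique κ (Fin 2)).symm
  obtain ⟨e, he⟩ := Orthonormal.exists_orthonormalBasis_extension_of_card_eq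
    (ι := κ → Fin 2) (𝕜 := ℂ) (v := fun _ => ψ) (s := {c 0}) (by simp)
    ⟨fun _ => hψ, fun k l h => (h (Subsingleton.elim k l)).elim⟩
  have hsum := sum_expectation_orthonormalBasis e X
  rw [hX, ← c.sum_comp, Fin.sum_univ_two] at hsum
  have hzero : expectation (e (c 0)) X = 0 := by
    rw [he _ rfl, hψX]
  rw [hzero, zero_add] at hsum
  exact ⟨e, c.forall_congr_right.1 (Fin.forall_fin_two.2 ⟨hzero, hsum⟩)⟩

end ZeroExpectation

section TensorVec

variable {κ : Type*} [Fintype κ] [DecidableEq κ]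

/-- The tensor product of a vector of the qubits in `γ` and one of the remaining qubits. -/
noncomputable def tensorVec (γ : Finset κ) (f : Qubits {i // i ∈ γ}) (g : Qubits {i // i ∉ γ}) :
    Qubits κ :=
  WithLp.toLp 2 fun w => f (fun i => w i) * g (fun i => w i)

variable (γ : Finset κ)

lemma tensorVec_glue (f : Qubits {i // i ∈ γ}) (g : Qubits {i // i ∉ γ})
    (x : {i // i ∈ γ} → Fin 2) (z : {i // i ∉ γ} → Fin 2) :
    tensorVec γ f g (glue γ x z) = f x * g z := by
  simp [tensorVec]

lemma inner_tensorVec (f f' : Qubits {i // i ∈ γ}) (g g' : Qubits {i // i ∉ γ}) :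
    inner ℂ (tensorVec γ f g) (tensorVec γ f' g') = inner ℂ f f' * inner ℂ g g' := by
  simp only [PiLp.inner_apply, sum_glue γ, tensorVec_glue, Finset.sum_mul_sum, RCLike.inner_apply,
    map_mul, mul_mul_mul_comm]

lemma isProductVector_of_unique {κ : Type*} [Fintype κ] [Unique κ] (f : Qubits κ) :
    IsProductVector f :=
  ⟨fun _ => WithLp.toLp 2 fun t => f fun _ => t, fun x => by
    rw [Fintype.prod_unique]
    exact congrArg f (funext fun i => congrArg x (Subsingleton.elim i default))⟩

lemma IsProductVector.tensorVec {γ : Finset κ} {f : Qubits {i // i ∈ γ}}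
    {g : Qubits {i // i ∉ γ}} (hf : IsProductVector f) (hg : IsProductVector g) :
    IsProductVector (tensorVec γ f g) := by
  obtain ⟨u, hu⟩ := hf
  obtain ⟨v, hv⟩ := hg
  let p (i : κ) := if h : i ∈ γ then u ⟨i, h⟩ else v ⟨i, h⟩
  have hpos (i : {i // i ∈ γ}) : p i = u i := dif_pos i.2
  have hneg (i : {i // i ∉ γ}) : p i = v i := dif_neg i.2
  refine ⟨p, fun x => ?_⟩
  rw [← Fintype.prod_subtype_mul_prod_subtype (· ∈ γ)]
  simp only [hpos, hneg, _root_.tensorVec, hu, hv]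
  congr!

/-- The compression `(⟨f| ⊗ 1) X (|f⟩ ⊗ 1)` of `X` to the qubits outside `γ`. -/
def compression (γ : Finset κ) (f : Qubits {i // i ∈ γ})
    (X : Matrix (κ → Fin 2) (κ → Fin 2) ℂ) :
    Matrix ({i // i ∉ γ} → Fin 2) ({i // i ∉ γ} → Fin 2) ℂ :=
  of fun z z' => star f.ofLp ⬝ᵥ X.submatrix (glue γ · z) (glue γ · z') *ᵥ f.ofLp

lemma trace_compression (f : Qubits {i // i ∈ γ}) (X : Matrix (κ → Fin 2) (κ → Fin 2) ℂ) :
    (compression γ f X).trace.re =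
      expectation f (∑ z : {i // i ∉ γ} → Fin 2, X.submatrix (glue γ · z) (glue γ · z)) := by
  change _ = (star f.ofLp ⬝ᵥ _ *ᵥ f.ofLp).re
  rw [sum_mulVec, dotProduct_sum]
  rfl

lemma expectation_tensorVec (f : Qubits {i // i ∈ γ}) (g : Qubits {i // i ∉ γ})
    (X : Matrix (κ → Fin 2) (κ → Fin 2) ℂ) :
    expectation (tensorVec γ f g) X = expectation g (compression γ f X) := by
  have hcomm (F : ({i // i ∈ γ} → Fin 2) → ({i // i ∉ γ} → Fin 2) → ℂ) :
      ∑ x, ∑ z, F x z = ∑ z, ∑ x, F x z := Finset.sum_comm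
  simp only [expectation, compression, mulVec, dotProduct, of_apply, submatrix_apply, sum_glue γ,
    tensorVec_glue, star_mul', Pi.star_apply, Finset.mul_sum, Finset.sum_mul]
  rw [hcomm]
  refine congrArg Complex.re (Finset.sum_congr rfl fun z _ => ?_)
  conv_rhs => rw [Finset.sum_comm]
  refine Finset.sum_congr rfl fun x _ => ?_
  rw [hcomm]
  refine Finset.sum_congr rfl fun z' _ => Finset.sum_congr rfl fun x' _ => ?_
  ring

lemma exists_orthonormalBasis_tensorVec
    (f : OrthonormalBasis ({i // i ∈ γ} → Fin 2) ℂ (Qubits {i // i ∈ γ}))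
    (g : ({i // i ∈ γ} → Fin 2) →
      OrthonormalBasis ({i // i ∉ γ} → Fin 2) ℂ (Qubits {i // i ∉ γ})) :
    ∃ e : OrthonormalBasis (κ → Fin 2) ℂ (Qubits κ),
      ∀ x z, e (glue γ x z) = tensorVec γ (f x) (g x z) := by
  let E (k : ({i // i ∈ γ} → Fin 2) × ({i // i ∉ γ} → Fin 2)) := tensorVec γ (f k.1) (g k.1 k.2)
  have hE : Orthonormal ℂ E := by
    rw [orthonormal_iff_ite]
    rintro ⟨x, z⟩ ⟨x', z'⟩
    obtain rfl | hx := eq_or_ne x x'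
    · simp [E, inner_tensorVec, OrthonormalBasis.inner_eq_ite]
    · simp [E, inner_tensorVec, hx]
  let split := Equiv.piEquivPiSubtypeProd (· ∈ γ) fun _ => Fin 2
  obtain ⟨e, he⟩ := Orthonormal.exists_orthonormalBasis_extension_of_card_eq
    (𝕜 := ℂ) (v := E) (s := Set.univ)
    (by rw [finrank_euclideanSpace, Fintype.card_congr split])
    (hE.comp _ Subtype.val_injective)
  refine ⟨e.reindex split.symm, fun x z => ?_⟩
  rw [e.reindex_apply, Equiv.symm_symm, he _ (Set.mem_univ _)]
  exact congrArg E (split.apply_symm_apply (x, z))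

end TensorVec

section ProductBasis

-- Measure one qubit so that both outcomes leave a compression of trace zero on the remaining ones.
theorem exists_productBasis_expectation_eq_zero {κ : Type*} [Fintype κ] [DecidableEq κ]
    {X : Matrix (κ → Fin 2) (κ → Fin 2) ℂ} (hX : X.trace.re = 0) :
    ∃ e : OrthonormalBasis (κ → Fin 2) ℂ (Qubits κ),
      (∀ k, IsProductVector (e k)) ∧ ∀ k, expectation (e k) X = 0 := by
  induction hn : Fintype.card κ using Nat.strong_induction_on generalizing κ with
  | _ n ih =>
  obtain hκ | ⟨⟨i⟩⟩ := isEmpty_or_nonempty κ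
  · let e := EuclideanSpace.basisFun (κ → Fin 2) ℂ
    refine ⟨e, fun k => ⟨isEmptyElim, fun x => ?_⟩, fun k => ?_⟩
    · simp [e, Subsingleton.elim x k]
    · rw [← hX, ← sum_expectation_orthonormalBasis e, Fintype.sum_subsingleton _ k]
  have htr : (∑ z, X.submatrix (glue {i} · z) (glue {i} · z)).trace.re = 0 := by
    rw [← hX, trace_sum, trace, sum_glue {i}, Finset.sum_comm]
    rfl
  obtain ⟨f, hf⟩ := exists_orthonormalBasis_expectation_eq_zero_of_unique htr
  have hcard : Fintype.card {k // k ∉ ({i} : Finset κ)} < n :=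
    hn ▸ Fintype.card_subtype_lt (x := i) (by simp)
  choose g hgprod hg using fun x => ih _ hcard (X := compression {i} (f x) X)
    (by rw [trace_compression, hf]) rfl
  obtain ⟨e, he⟩ := exists_orthonormalBasis_tensorVec {i} f g
  have hsplit (k : κ → Fin 2) :
      k = glue {i} (fun l : {l // l ∈ ({i} : Finset κ)} => k l) fun l => k l := by
    ext l
    simp [glue]
  refine ⟨e, fun k => ?_, fun k => ?_⟩ <;> rw [hsplit k, he]
  · exact (isProductVector_of_unique _).tensorVec (hgprod _ _)
  · rw [expectation_tensorVec, hg]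

end ProductBasis

section Attainment

lemma continuous_norm_sq_mul_normalize {H : Type*} [NormedAddCommGroup H] [NormedSpace ℂ H]
    [ProperSpace H] {E : H → ℝ} (hE : Continuous E) :
    Continuous fun v : H => ‖v‖ ^ 2 * E ((‖v‖ : ℂ)⁻¹ • v) := by
  refine continuous_iff_continuousAt.2 fun v => ?_
  obtain rfl | hv := eq_or_ne v 0
  · obtain ⟨C, hC⟩ := (isCompact_closedBall (0 : H) 1).exists_bound_of_continuousOn hE.continuousOn
    have hbound (w : H) : ‖‖w‖ ^ 2 * E ((‖w‖ : ℂ)⁻¹ • w)‖ ≤ ‖w‖ ^ 2 * C := by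
      rw [norm_mul, norm_pow, norm_norm]
      refine mul_le_mul_of_nonneg_left (hC _ (mem_closedBall_zero_iff.2 ?_)) (by positivity)
      rw [norm_smul, norm_inv, Complex.norm_real, norm_norm]
      exact inv_mul_le_one
    have hlim : Filter.Tendsto (fun w : H => ‖w‖ ^ 2 * C) (nhds 0) (nhds 0) :=
      Continuous.tendsto' (by fun_prop) _ _ (by simp)
    simpa [ContinuousAt] using squeeze_zero_norm hbound hlim
  · have hinv : ContinuousAt (fun w : H => (‖w‖ : ℂ)⁻¹) v :=
      ContinuousAt.inv₀ (by fun_prop) (by simpa using hv)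
    exact (by fun_prop : ContinuousAt (fun w : H => ‖w‖ ^ 2) v).mul
      (hE.continuousAt.comp (hinv.smul continuousAt_id))

variable {κ : Type*} [Fintype κ]

/-- The product vector `⨂_k v_k`. -/
noncomputable def productVector (v : κ → EuclideanSpace ℂ (Fin 2)) : Qubits κ :=
  WithLp.toLp 2 fun x => ∏ k, v k (x k)

lemma isProductVector_iff_exists_productVector {f : Qubits κ} :
    IsProductVector f ↔ ∃ v, productVector v = f :=
  exists_congr fun _ => ⟨fun h => by ext x; exact (h x).symm, fun h x => by rw [← h]; rfl⟩

lemma productVector_smul (c : κ → ℂ) (v : κ → EuclideanSpace ℂ (Fin 2)) :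
    productVector (fun k => c k • v k) = (∏ k, c k) • productVector v := by
  ext x
  simp [productVector, Finset.prod_mul_distrib]

lemma continuous_productVector : Continuous (productVector (κ := κ)) := by
  unfold productVector
  fun_prop

variable [DecidableEq κ]

lemma norm_productVector (v : κ → EuclideanSpace ℂ (Fin 2)) :
    ‖productVector v‖ = ∏ k, ‖v k‖ := by
  refine (sq_eq_sq₀ (norm_nonneg _) (Finset.prod_nonneg fun _ _ => norm_nonneg _)).1 ?_
  simp only [EuclideanSpace.norm_sq_eq, ← Finset.prod_pow, productVector, norm_prod]
  exact (Fintype.prod_sum fun k t => ‖v k t‖ ^ 2).symm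

lemma isCompact_unit_productVectors :
    IsCompact {f : Qubits κ | IsProductVector f ∧ ‖f‖ = 1} := by
  have himage : {f : Qubits κ | IsProductVector f ∧ ‖f‖ = 1} =
      productVector '' Set.univ.pi fun _ => Metric.sphere 0 1 := by
    ext f
    simp only [isProductVector_iff_exists_productVector, Set.mem_ofPred_eq, Set.mem_image,
      Set.mem_univ_pi, mem_sphere_zero_iff_norm]
    constructor
    · rintro ⟨⟨v, rfl⟩, hv⟩
      rw [norm_productVector] at hv
      have hne (k) : v k ≠ 0 := norm_ne_zero_iff.1
        (Finset.prod_ne_zero_iff.1 (hv.trans_ne one_ne_zero) k (Finset.mem_univ k))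
      refine ⟨fun k => (‖v k‖⁻¹ : ℂ) • v k, fun k => norm_smul_inv_norm (hne k), ?_⟩
      rw [productVector_smul, Finset.prod_inv_distrib, ← Complex.ofReal_prod, hv,
        Complex.ofReal_one, inv_one, one_smul]
    · rintro ⟨v, hv, rfl⟩
      exact ⟨⟨v, rfl⟩, by simp [norm_productVector, hv]⟩
  rw [himage]
  exact (isCompact_univ_pi fun _ => isCompact_sphere _ _).image continuous_productVector

variable (A : Finset κ) (Ψ : Qubits κ)

lemma continuous_postVector : Continuous fun f => postVector A f Ψ := by
  unfold postVector
  fun_prop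

lemma isCompact_localAverages {E : Qubits {i // i ∉ A} → ℝ} (hE : Continuous E) :
    IsCompact (localAverages A E Ψ) := by
  let K : Set (({i // i ∈ A} → Fin 2) → Qubits {i // i ∈ A}) :=
    (Set.univ.pi fun _ => {f | IsProductVector f ∧ ‖f‖ = 1}) ∩ {F | Orthonormal ℂ F}
  have hK : IsCompact K := by
    refine (isCompact_univ_pi fun _ => isCompact_unit_productVectors).inter_right ?_
    simp only [orthonormal_iff_ite, Set.ofPred_forall]
    exact isClosed_iInter fun k => isClosed_iInter fun l =>
      isClosed_eq (by fun_prop) continuous_const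
  let avg (F : ({i // i ∈ A} → Fin 2) → Qubits {i // i ∈ A}) : ℝ :=
    ∑ k, ‖postVector A (F k) Ψ‖ ^ 2 *
      E ((‖postVector A (F k) Ψ‖ : ℂ)⁻¹ • postVector A (F k) Ψ)
  have havg : Continuous avg := continuous_finsetSum _ fun k _ =>
    (continuous_norm_sq_mul_normalize hE).comp
      ((continuous_postVector A Ψ).comp (continuous_apply k))
  suffices localAverages A E Ψ = avg '' K from this ▸ hK.image havg
  ext r
  constructor
  · rintro ⟨e, he, rfl⟩
    exact ⟨e, ⟨fun k _ => ⟨he k, e.orthonormal.1 k⟩, e.orthonormal⟩, rfl⟩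
  · rintro ⟨F, ⟨hF, hortho⟩, rfl⟩
    obtain ⟨e, he⟩ := Orthonormal.exists_orthonormalBasis_extension_of_card_eq
      (𝕜 := ℂ) (v := F) (s := Set.univ) finrank_euclideanSpace
      (hortho.comp _ Subtype.val_injective)
    obtain rfl : ⇑e = F := funext fun k => he k (Set.mem_univ k)
    exact ⟨e, fun k => (hF k (Set.mem_univ k)).1, rfl⟩

theorem isGreatest_localizableEntanglement {E : Qubits {i // i ∉ A} → ℝ} (hE : Continuous E) :
    IsGreatest (localAverages A E Ψ) (localizableEntanglement A E Ψ) := by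
  obtain ⟨e, he, -⟩ := exists_productBasis_expectation_eq_zero
    (X := (0 : Matrix ({i // i ∈ A} → Fin 2) ({i // i ∈ A} → Fin 2) ℂ)) (by simp)
  exact (isCompact_localAverages A Ψ hE).isGreatest_sSup ⟨_, e, he, rfl⟩

end Attainment

section Continuity

variable {κ : Type*} [Fintype κ] [DecidableEq κ]

lemma continuous_purity (γ : Finset κ) : Continuous fun ψ : Qubits κ => purity ψ γ := by
  simp only [purity, pow_two, trace, diag, mul_apply, reducedState]
  fun_prop

lemma continuous_concentratableEntanglement (s : Finset κ) :
    Continuous (concentratableEntanglement s) :=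
  continuous_const.sub
    (continuous_const.mul (continuous_finsetSum _ fun γ _ => continuous_purity γ))

lemma continuous_sqrtCE (s : Finset κ) : Continuous (sqrtCE s) :=
  Real.continuous_sqrt.comp (continuous_concentratableEntanglement s)

end Continuity

section Averages

variable {κ : Type*} [Fintype κ] [DecidableEq κ]

lemma norm_sq_mul_expectation_normalize (φ : Qubits κ)
    (X : Matrix (κ → Fin 2) (κ → Fin 2) ℂ) :
    ‖φ‖ ^ 2 * expectation ((‖φ‖ : ℂ)⁻¹ • φ) X = expectation φ X := by
  obtain rfl | hφ := eq_or_ne φ 0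
  · simp [expectation]
  · rw [expectation_smul_left, norm_inv, Complex.norm_real, norm_norm, ← mul_assoc, ← mul_pow,
      mul_inv_cancel₀ (norm_ne_zero_iff.2 hφ), one_pow, one_mul]

variable {A : Finset κ} {Ψ : Qubits κ}
  {e : OrthonormalBasis ({i // i ∈ A} → Fin 2) ℂ (Qubits {i // i ∈ A})}

lemma averageEntanglement_mono {E E' : Qubits {i // i ∉ A} → ℝ}
    (hE : ∀ φ, ‖φ‖ = 1 → E φ ≤ E' φ) :
    averageEntanglement A E Ψ e ≤ averageEntanglement A E' Ψ e := by
  refine Finset.sum_le_sum fun k _ => ?_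
  obtain hk | hk := eq_or_ne (postVector A (e k) Ψ) 0
  · simp [hk]
  · exact mul_le_mul_of_nonneg_left (hE _ (norm_smul_inv_norm hk)) (sq_nonneg _)

lemma mul_abs_averageEntanglement_le (E : Qubits {i // i ∉ A} → ℝ) {c : ℝ} (hc : 0 ≤ c) :
    c * |averageEntanglement A E Ψ e| ≤ averageEntanglement A (fun φ => c * |E φ|) Ψ e := by
  refine (mul_le_mul_of_nonneg_left (Finset.abs_sum_le_sum_abs _ _) hc).trans_eq ?_
  rw [Finset.mul_sum]
  refine Finset.sum_congr rfl fun k _ => ?_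
  rw [abs_mul, abs_of_nonneg (sq_nonneg _), mul_left_comm]

lemma sum_expectation_postVector
    (X : Matrix ({i // i ∉ A} → Fin 2) ({i // i ∉ A} → Fin 2) ℂ) :
    ∑ k, expectation (postVector A (e k) Ψ) X = (weightedReducedState A Ψ X).trace.re := by
  simp only [expectation_postVector, sum_expectation_orthonormalBasis]

lemma sum_norm_sq_postVector : ∑ k, ‖postVector A (e k) Ψ‖ ^ 2 = ‖Ψ‖ ^ 2 := by
  simp only [← expectation_one]
  rw [sum_expectation_postVector, weightedReducedState_one, trace_reducedState, expectation_one]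
  norm_cast

lemma averageEntanglement_sqrtCE_le (hΨ : ‖Ψ‖ = 1) (s : Finset {i // i ∉ A}) :
    averageEntanglement A (sqrtCE s) Ψ e ≤
      √(averageEntanglement A (concentratableEntanglement s) Ψ e) := by
  have hprob : ∑ k, ‖postVector A (e k) Ψ‖ ^ 2 = 1 := by
    rw [sum_norm_sq_postVector, hΨ, one_pow]
  have hjensen := Real.pow_arith_mean_le_arith_mean_pow Finset.univ
    (fun k => ‖postVector A (e k) Ψ‖ ^ 2)
    (fun k => sqrtCE s ((‖postVector A (e k) Ψ‖ : ℂ)⁻¹ • postVector A (e k) Ψ))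
    (fun k _ => sq_nonneg _) hprob (fun k _ => Real.sqrt_nonneg _) 2
  refine Real.le_sqrt_of_sq_le (hjensen.trans (averageEntanglement_mono
    (E := fun φ => sqrtCE s φ ^ 2) fun φ hφ => ?_))
  exact (Real.sq_sqrt (concentratableEntanglement_nonneg s hφ)).le

theorem localizableEntanglement_sqrtCE_le (hΨ : ‖Ψ‖ = 1) (s : Finset {i // i ∉ A}) :
    localizableEntanglement A (sqrtCE s) Ψ ≤
      √(localizableEntanglement A (concentratableEntanglement s) Ψ) := by
  obtain ⟨e, he, h⟩ := (isGreatest_localizableEntanglement A Ψ (continuous_sqrtCE s)).1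
  rw [h]
  refine (averageEntanglement_sqrtCE_le hΨ s).trans (Real.sqrt_le_sqrt ?_)
  exact (isGreatest_localizableEntanglement A Ψ (continuous_concentratableEntanglement s)).2
    ⟨e, he, rfl⟩

end Averages

section CorrelationBound

variable {κ : Type*} [Fintype κ] [DecidableEq κ] {A : Finset κ} {Ψ : Qubits κ}

lemma expectation_tensorOp_of_forall_mem_eq_one {M : κ → Matrix (Fin 2) (Fin 2) ℂ}
    (hM : ∀ k ∈ A, M k = 1) :
    expectation Ψ (tensorOp M) =
      (weightedReducedState A Ψ (tensorOp fun k : {i // i ∉ A} => M k)).trace.re := by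
  have hA : (fun k : {i // i ∈ A} => M k) = fun _ => 1 := funext fun k => hM k k.2
  rw [expectation_tensorOp A, hA, tensorOp_one, Matrix.one_mul]

-- The basis is chosen so that the diagonal of the traceless operator
-- `weightedReducedState A Ψ (T - ⟨T⟩)` vanishes.
lemma exists_productBasis_expectation_postVector_eq (hΨ : ‖Ψ‖ = 1)
    (T : Matrix ({i // i ∉ A} → Fin 2) ({i // i ∉ A} → Fin 2) ℂ) :
    ∃ e : OrthonormalBasis ({i // i ∈ A} → Fin 2) ℂ (Qubits {i // i ∈ A}),
      (∀ k, IsProductVector (e k)) ∧ ∀ k, expectation (postVector A (e k) Ψ) T =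
        (weightedReducedState A Ψ T).trace.re * ‖postVector A (e k) Ψ‖ ^ 2 := by
  set c := (weightedReducedState A Ψ T).trace.re
  obtain ⟨e, he, hzero⟩ := exists_productBasis_expectation_eq_zero
    (X := weightedReducedState A Ψ T + ((-c : ℝ) : ℂ) • weightedReducedState A Ψ 1) (by
      rw [trace_add, trace_smul, weightedReducedState_one, trace_reducedState, hΨ]
      simp [c])
  refine ⟨e, he, fun k => ?_⟩
  have h := hzero k
  rw [expectation_add, expectation_smul, ← expectation_postVector, ← expectation_postVector,
    expectation_one] at h
  linarith

lemma spinCorrelation_eq_trace_weightedReducedState {i j : {k // k ∉ A}}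
    (a b : EuclideanSpace ℝ (Fin 3)) :
    spinCorrelation Ψ i j a b =
      (weightedReducedState A Ψ (tensorOp (Function.update (Function.update (fun _ => 1) i
          (spin a)) j (spin b)))).trace.re -
        (weightedReducedState A Ψ (tensorOp (Function.update (fun _ => 1) i (spin a)))).trace.re *
          (weightedReducedState A Ψ
            (tensorOp (Function.update (fun _ => 1) j (spin b)))).trace.re := by
  have hupdate {M : κ → Matrix (Fin 2) (Fin 2) ℂ} (hM : ∀ l ∈ A, M l = 1) (k : {k // k ∉ A})
      (X) : ∀ l ∈ A, Function.update M k X l = 1 := fun l hl => by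
    rw [Function.update_of_ne (ne_of_mem_of_not_mem hl k.2), hM l hl]
  have hone : ∀ l ∈ A, (fun _ : κ => (1 : Matrix (Fin 2) (Fin 2) ℂ)) l = 1 := fun _ _ => rfl
  rw [spinCorrelation,
    expectation_tensorOp_of_forall_mem_eq_one (hupdate (hupdate hone i (spin a)) j (spin b)),
    expectation_tensorOp_of_forall_mem_eq_one (hupdate hone i (spin a)),
    expectation_tensorOp_of_forall_mem_eq_one (hupdate hone j (spin b))]
  simp only [restrict_update]

lemma exists_productBasis_averageEntanglement_spinCorrelation (hΨ : ‖Ψ‖ = 1)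
    {i j : {k // k ∉ A}} (a b : EuclideanSpace ℝ (Fin 3)) :
    ∃ e : OrthonormalBasis ({i // i ∈ A} → Fin 2) ℂ (Qubits {i // i ∈ A}),
      (∀ k, IsProductVector (e k)) ∧
        averageEntanglement A (fun φ => spinCorrelation φ i j a b) Ψ e =
          spinCorrelation Ψ i j a b := by
  obtain ⟨e, he, hmean⟩ := exists_productBasis_expectation_postVector_eq hΨ
    (tensorOp (Function.update (fun _ => 1) i (spin a)))
  refine ⟨e, he, ?_⟩
  rw [spinCorrelation_eq_trace_weightedReducedState, ← sum_expectation_postVector (e := e),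
    ← sum_expectation_postVector (e := e) (tensorOp (Function.update _ j _)), Finset.mul_sum,
    ← Finset.sum_sub_distrib]
  refine Finset.sum_congr rfl fun k _ => ?_
  simp only [spinCorrelation]
  rw [mul_sub, norm_sq_mul_expectation_normalize, ← mul_assoc,
    norm_sq_mul_expectation_normalize, hmean, mul_assoc, norm_sq_mul_expectation_normalize]

theorem half_abs_spinCorrelation_le_localizableEntanglement (hΨ : ‖Ψ‖ = 1)
    {s : Finset {i // i ∉ A}} {i j : {k // k ∉ A}} (hi : i ∈ s) (hij : i ≠ j)
    {a b : EuclideanSpace ℝ (Fin 3)} (ha : ‖a‖ = 1) (hb : ‖b‖ = 1) :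
    1 / 2 * |spinCorrelation Ψ i j a b| ≤ localizableEntanglement A (sqrtCE s) Ψ := by
  obtain ⟨e, he, hmean⟩ := exists_productBasis_averageEntanglement_spinCorrelation hΨ a b
  rw [← hmean]
  calc _ ≤ averageEntanglement A (fun φ => 1 / 2 * |spinCorrelation φ i j a b|) Ψ e :=
        mul_abs_averageEntanglement_le _ one_half_pos.le
    _ ≤ averageEntanglement A (sqrtCE s) Ψ e :=
        averageEntanglement_mono fun φ hφ => half_abs_spinCorrelation_le_sqrtCE hφ hij ha hb hi
    _ ≤ _ := (isGreatest_localizableEntanglement A Ψ (continuous_sqrtCE s)).2 ⟨e, he, rfl⟩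

end CorrelationBound

section SingularValues

variable {E F : Type*} [NormedAddCommGroup E] [InnerProductSpace ℝ E] [FiniteDimensional ℝ E]
  [NormedAddCommGroup F] [InnerProductSpace ℝ F] [FiniteDimensional ℝ F] (T : E →ₗ[ℝ] F)

lemma norm_apply_sq_eq_inner_adjoint_comp (v : E) :
    ‖T v‖ ^ 2 = inner ℝ v ((LinearMap.adjoint T ∘ₗ T) v) := by
  rw [LinearMap.comp_apply, LinearMap.adjoint_inner_right, real_inner_self_eq_norm_sq]

lemma norm_apply_le_singularValue_zero (v : E) : ‖T v‖ ≤ T.singularValues 0 * ‖v‖ := by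
  have hT := T.isSymmetric_adjoint_comp_self
  set B := hT.eigenvectorBasis rfl
  refine le_of_sq_le_sq ?_ (mul_nonneg (T.singularValues_nonneg 0) (norm_nonneg v))
  rw [norm_apply_sq_eq_inner_adjoint_comp, ← B.sum_inner_mul_inner, mul_pow,
    ← B.sum_sq_norm_inner_right v, Finset.mul_sum]
  refine Finset.sum_le_sum fun i _ => ?_
  have hinner : inner ℝ (B i) ((LinearMap.adjoint T ∘ₗ T) v) =
      T.singularValues i ^ 2 * inner ℝ (B i) v := by
    rw [T.sq_singularValues_fin rfl i, ← hT (B i) v, hT.apply_eigenvectorBasis]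
    exact real_inner_smul_left _ _ _
  rw [hinner, real_inner_comm v, Real.norm_eq_abs, sq_abs, mul_left_comm, ← pow_two]
  have hanti := T.singularValues_antitone (Nat.zero_le i)
  gcongr
  exact T.singularValues_nonneg _

lemma exists_norm_apply_eq_singularValue_zero [Nontrivial E] :
    ∃ v : E, ‖v‖ = 1 ∧ ‖T v‖ = T.singularValues 0 := by
  have hT := T.isSymmetric_adjoint_comp_self
  set B := hT.eigenvectorBasis rfl
  have hB := B.orthonormal.1 ⟨0, Module.finrank_pos⟩
  refine ⟨_, hB, (sq_eq_sq₀ (norm_nonneg _) (T.singularValues_nonneg 0)).1 ?_⟩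
  rw [norm_apply_sq_eq_inner_adjoint_comp, hT.apply_eigenvectorBasis, inner_smul_right,
    real_inner_self_eq_norm_sq, hB, T.sq_singularValues_of_lt rfl Module.finrank_pos, one_pow,
    mul_one]
  rfl

lemma isGreatest_abs_inner_apply [Nontrivial E] [Nontrivial F] :
    IsGreatest {r | ∃ (a : F) (b : E), ‖a‖ = 1 ∧ ‖b‖ = 1 ∧ r = |inner ℝ a (T b)|}
      (T.singularValues 0) := by
  constructor
  · obtain ⟨b, hb, hTb⟩ := exists_norm_apply_eq_singularValue_zero T
    rw [← hTb]
    obtain hzero | hne := eq_or_ne (T b) 0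
    · obtain ⟨a, ha⟩ := exists_norm_eq F zero_le_one
      exact ⟨a, b, ha, hb, by rw [hzero, inner_zero_right, abs_zero, norm_zero]⟩
    · refine ⟨‖T b‖⁻¹ • T b, b, norm_smul_inv_norm (𝕜 := ℝ) hne, hb, ?_⟩
      rw [real_inner_smul_left, real_inner_self_eq_norm_sq, pow_two,
        inv_mul_cancel_left₀ (norm_ne_zero_iff.2 hne), abs_norm]
  · rintro r ⟨a, b, ha, hb, rfl⟩
    calc |inner ℝ a (T b)| ≤ ‖a‖ * ‖T b‖ := abs_real_inner_le_norm _ _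
      _ = ‖T b‖ := by rw [ha, one_mul]
      _ ≤ T.singularValues 0 := by simpa [hb] using norm_apply_le_singularValue_zero T b

end SingularValues

section MaximalCorrelation

variable {κ : Type*} [Fintype κ] [DecidableEq κ] (Ψ : Qubits κ)

lemma spin_single (p : Fin 3) : spin (EuclideanSpace.single p 1) = pauli p := by
  simp [spin]

lemma expectation_tensorOp_update_spin (M : κ → Matrix (Fin 2) (Fin 2) ℂ) (i : κ)
    (a : EuclideanSpace ℝ (Fin 3)) :
    expectation Ψ (tensorOp (Function.update M i (spin a))) =
      ∑ p, a p * expectation Ψ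
        (tensorOp (Function.update M i (spin (EuclideanSpace.single p 1)))) := by
  simp only [expectation_tensorOp_eq_trace_qubitState i,
    restrict_update_of_mem _ _ (Finset.mem_singleton_self i), Function.update_self, spin_single]
  simp only [spin, Finset.sum_mul, trace_sum, Complex.re_sum, smul_mul_assoc, trace_smul,
    smul_eq_mul, Complex.re_ofReal_mul]

lemma spinCorrelation_eq_sum_left {i j : κ} (hij : i ≠ j) (a b : EuclideanSpace ℝ (Fin 3)) :
    spinCorrelation Ψ i j a b =
      ∑ p, a p * spinCorrelation Ψ i j (EuclideanSpace.single p 1) b := by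
  simp only [spinCorrelation, Function.update_comm hij]
  rw [expectation_tensorOp_update_spin _ _ i, expectation_tensorOp_update_spin _ _ i a,
    Finset.sum_mul, ← Finset.sum_sub_distrib]
  exact Finset.sum_congr rfl fun q _ => by ring

lemma spinCorrelation_eq_sum_right (i j : κ) (a b : EuclideanSpace ℝ (Fin 3)) :
    spinCorrelation Ψ i j a b =
      ∑ q, b q * spinCorrelation Ψ i j a (EuclideanSpace.single q 1) := by
  simp only [spinCorrelation]
  rw [expectation_tensorOp_update_spin _ _ j, expectation_tensorOp_update_spin _ _ j b,
    Finset.mul_sum, ← Finset.sum_sub_distrib]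
  exact Finset.sum_congr rfl fun q _ => by ring

variable {i j : κ}

lemma spinCorrelation_eq_inner (hij : i ≠ j) (a b : EuclideanSpace ℝ (Fin 3)) :
    spinCorrelation Ψ i j a b = inner ℝ a (toEuclideanLin (correlationMatrix Ψ i j) b) := by
  rw [spinCorrelation_eq_sum_left Ψ hij, PiLp.inner_apply]
  refine Finset.sum_congr rfl fun p _ => ?_
  rw [spinCorrelation_eq_sum_right, mul_comm]
  exact congrArg (· * a p) (Finset.sum_congr rfl fun q _ => mul_comm _ _)

theorem isGreatest_pairCorrelations (hij : i ≠ j) :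
    IsGreatest (pairCorrelations Ψ i j) (maxSingularValue (correlationMatrix Ψ i j)) := by
  have h := isGreatest_abs_inner_apply (toEuclideanLin (correlationMatrix Ψ i j))
  simp_rw [← spinCorrelation_eq_inner Ψ hij] at h
  exact h

theorem exists_isGreatest_allCorrelations {S : Set κ} (hS : S.Nontrivial) :
    ∃ i ∈ S, ∃ j ∈ S, i ≠ j ∧
      IsGreatest (allCorrelations Ψ S) (maxSingularValue (correlationMatrix Ψ i j)) := by
  obtain ⟨⟨i, j⟩, ⟨hi, hj, hij⟩, hmax⟩ := Set.exists_max_image S.offDiag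
    (fun q => maxSingularValue (correlationMatrix Ψ q.1 q.2)) S.offDiag.toFinite
    (Set.offDiag_nonempty.2 hS)
  refine ⟨i, hi, j, hj, hij, ⟨i, hi, j, hj, hij, (isGreatest_pairCorrelations Ψ hij).1⟩, ?_⟩
  rintro r ⟨i', hi', j', hj', hij', hr⟩
  exact ((isGreatest_pairCorrelations Ψ hij').2 hr).trans (hmax (i', j') ⟨hi', hj', hij'⟩)

theorem isGreatest_maxCorrelation {S : Set κ} (hS : S.Nontrivial) :
    IsGreatest (allCorrelations Ψ S) (maxCorrelation Ψ S) := by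
  obtain ⟨i, -, j, -, -, h⟩ := exists_isGreatest_allCorrelations Ψ hS
  rwa [maxCorrelation, h.csSup_eq]

theorem exists_maxCorrelation_eq_maxSingularValue {S : Set κ} (hS : S.Nontrivial) :
    ∃ i ∈ S, ∃ j ∈ S, i ≠ j ∧
      maxCorrelation Ψ S = maxSingularValue (correlationMatrix Ψ i j) := by
  obtain ⟨i, hi, j, hj, hij, h⟩ := exists_isGreatest_allCorrelations Ψ hS
  exact ⟨i, hi, j, hj, hij, h.csSup_eq⟩

variable {A : Finset κ} {Ψ}

lemma localizableEntanglement_sqrtCE_nonneg (s : Finset {i // i ∉ A}) :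
    0 ≤ localizableEntanglement A (sqrtCE s) Ψ := by
  obtain ⟨e, -, h⟩ := (isGreatest_localizableEntanglement A Ψ (continuous_sqrtCE s)).1
  rw [h]
  exact Finset.sum_nonneg fun k _ => mul_nonneg (sq_nonneg _) (Real.sqrt_nonneg _)

theorem half_maxCorrelation_le_localizableEntanglement (hΨ : ‖Ψ‖ = 1)
    (s : Finset {i // i ∉ A}) :
    1 / 2 * maxCorrelation Ψ (Subtype.val '' (s : Set {i // i ∉ A})) ≤
      localizableEntanglement A (sqrtCE s) Ψ := by
  suffices maxCorrelation Ψ (Subtype.val '' (s : Set {i // i ∉ A})) ≤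
      2 * localizableEntanglement A (sqrtCE s) Ψ by linarith
  refine Real.sSup_le ?_ (mul_nonneg zero_le_two (localizableEntanglement_sqrtCE_nonneg s))
  rintro r ⟨_, ⟨i, hi, rfl⟩, _, ⟨j, -, rfl⟩, hij, a, b, ha, hb, rfl⟩
  linarith [half_abs_spinCorrelation_le_localizableEntanglement hΨ hi
    (ne_of_apply_ne _ hij) ha hb]

end MaximalCorrelation

end

theorem mainTheorem7_general {κ : Type*} [Fintype κ] [DecidableEq κ] (A : Finset κ)
    (s : Finset {i // i ∉ A}) (Ψ : Qubits κ) (hΨ : ‖Ψ‖ = 1) :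
    IsGreatest (localAverages A (concentratableEntanglement s) Ψ)
        (localizableEntanglement A (concentratableEntanglement s) Ψ) ∧
    IsGreatest (localAverages A (sqrtCE s) Ψ) (localizableEntanglement A (sqrtCE s) Ψ) ∧
    localizableEntanglement A (sqrtCE s) Ψ ≤
        √(localizableEntanglement A (concentratableEntanglement s) Ψ) ∧
    (1 / 2) * maxCorrelation Ψ (Subtype.val '' (s : Set {i // i ∉ A})) ≤
        localizableEntanglement A (sqrtCE s) Ψ ∧
    (∀ i ∈ s, ∀ j ∈ s, i ≠ j →
      IsGreatest (pairCorrelations Ψ i j) (maxSingularValue (correlationMatrix Ψ i j))) ∧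
    (s.Nontrivial →
      IsGreatest (allCorrelations Ψ (Subtype.val '' (s : Set {i // i ∉ A})))
        (maxCorrelation Ψ (Subtype.val '' (s : Set {i // i ∉ A}))) ∧
      ∃ i ∈ s, ∃ j ∈ s, i ≠ j ∧
        maxCorrelation Ψ (Subtype.val '' (s : Set {i // i ∉ A})) =
          maxSingularValue (correlationMatrix Ψ i j)) := by
  refine ⟨isGreatest_localizableEntanglement A Ψ (continuous_concentratableEntanglement s),
    isGreatest_localizableEntanglement A Ψ (continuous_sqrtCE s),
    localizableEntanglement_sqrtCE_le hΨ s,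
    half_maxCorrelation_le_localizableEntanglement hΨ s,
    fun i _ j _ hij => isGreatest_pairCorrelations Ψ (Subtype.val_injective.ne hij),
    fun hs => ?_⟩
  have hS : (Subtype.val '' (s : Set {i // i ∉ A})).Nontrivial :=
    (Finset.nontrivial_coe.2 hs).image Subtype.val_injective
  refine ⟨isGreatest_maxCorrelation Ψ hS, ?_⟩
  obtain ⟨_, ⟨i, hi, rfl⟩, _, ⟨j, hj, rfl⟩, hij, hmax⟩ :=
    exists_maxCorrelation_eq_maxSingularValue Ψ hS
  exact ⟨i, hi, j, hj, ne_of_apply_ne _ hij, hmax⟩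

theorem mainTheorem7 (N : ℕ) (A : Finset (Fin N)) (s : Finset {i : Fin N // i ∉ A})
    (hs : s.Nonempty) (Ψ : Qubits (Fin N)) (hΨ : ‖Ψ‖ = 1) :
    -- both localizable entanglements are maxima over the local measurements
    IsGreatest (localAverages A (concentratableEntanglement s) Ψ)
        (localizableEntanglement A (concentratableEntanglement s) Ψ) ∧
    IsGreatest (localAverages A (sqrtCE s) Ψ) (localizableEntanglement A (sqrtCE s) Ψ) ∧
    -- the two inequalities
    localizableEntanglement A (sqrtCE s) Ψ ≤
        √(localizableEntanglement A (concentratableEntanglement s) Ψ) ∧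
    (1 / 2) * maxCorrelation Ψ (Subtype.val '' (s : Set {i : Fin N // i ∉ A})) ≤
        localizableEntanglement A (sqrtCE s) Ψ ∧
    -- the maximum over the directions is the largest singular value of the correlation matrix
    (∀ i ∈ s, ∀ j ∈ s, i ≠ j →
      IsGreatest (pairCorrelations Ψ i j) (maxSingularValue (correlationMatrix Ψ i j))) ∧
    -- the maximum on the right-hand side exists and is the one for an optimal pair
    (s.Nontrivial →
      IsGreatest (allCorrelations Ψ (Subtype.val '' (s : Set {i : Fin N // i ∉ A})))
        (maxCorrelation Ψ (Subtype.val '' (s : Set {i : Fin N // i ∉ A}))) ∧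
      ∃ i ∈ s, ∃ j ∈ s, i ≠ j ∧
        maxCorrelation Ψ (Subtype.val '' (s : Set {i : Fin N // i ∉ A})) =
          maxSingularValue (correlationMatrix Ψ i j)) :=
  mainTheorem7_general A s Ψ hΨ
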